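/- Let $b\in\mathbb R$ (the product $b=\beta h$ of inverse temperature and external field, kept fixed as an independent parameter), $x\ge0$, $t\ge0$. For $N\ge1$ let $J_{ij}$ ($1\le i<j\le N$) and $J_i$ ($1\le i\le N$) be independent standard Gaussian random variables, let $E$ denote expectation over them, and for $\sigma\in\{-1,1\}^N$ set $$\mathcal E_{x,t}(\sigma)=\sqrt{\tfrac tN}\sum_{i<j}J_{ij}\sigma_i\sigma_j+b\sum_i\sigma_i+\sqrt x\sum_iJ_i\sigma_i,\qquad Z_N(x,t)=\sum_{\sigma}e^{\mathcal E_{x,t}(\sigma)},\qquad \alpha_N(x,t)=\frac1N E\log Z_N(x,t).$$ Let $\mu$ be the standard Gaussian measure on $\mathbb R$ and, for $x_0\ge0$, $\bar q(x_0)=\int\tanh^2(b+z\sqrt{x_0})\,d\mu(z)$. Let $x_0(x,t)$ be the solution $x_0\ge0$ of $x=x_0-\bar q(x_0)\,t$ (the largest one, if there are several, as happens only for $b=0$, $x=0$, $t>1$), let $\bar q(x,t)=\bar q(x_0(x,t))$, and let $$\bar\alpha(x,t)=\log2+\int\log\cosh\bigl(b+z\sqrt{x_0}\bigr)\,d\mu(z)+\frac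 t4\bigl(1-\bar q(x_0)\bigr)^2,\qquad x_0=x_0(x,t),$$ be the replica-symmetric Sherrington–Kirkpatrick value. With the overlap $q_{12}(\sigma,\sigma')=\frac1N\sum_i\sigma_i\sigma'_i$, define for $\lambda\ge0$ $$\tilde\alpha_N(x,\lambda,t)=\frac1{2N}E\log\sum_{\sigma,\sigma'}\exp\Bigl(\mathcal E_{x,t}(\sigma)+\mathcal E_{x,t}(\sigma')+\frac\lambda2N\bigl(q_{12}(\sigma,\sigma')-\bar q(x,t)\bigr)^2\Bigr),$$ $\Delta_N(x_0,\lambda_0)=\tilde\alpha_N(x_0,\lambda_0,0)-\alpha_N(x_0,0)$, and let $\lambda_c(x_0)\in[0,\infty]$ be the supremum of all $r\ge0$ such that $\lim_{N\to\infty}\Delta_N(x_0,\lambda_0)=0$ for every $0\le\lambda_0\le r$. Theorem. For all $b\in\mathbb R$, $x\ge0$ and $t\ge0$ with $t\le\lambda_c(x_0(x,t))$, $$\lim_{N\to\infty}\alpha_N(x,t)=\bar\alpha(x,t).$$ -/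

import Mathlib

open MeasureTheory ProbabilityTheory Filter Topology

noncomputable section

namespace SK

/-- Configurations of `N` Ising spins; the value of a spin is `spin (σ i)`. -/
abbrev Config (N : ℕ) : Type := Fin N → Bool

/-- The value `±1` of an Ising spin. -/
def spin (s : Bool) : ℝ := if s then 1 else -1

/-- The couples of sites `(i, j)`, each couple being listed once, with `i < j`. -/
abbrev Couple (N : ℕ) : Type := {p : Fin N × Fin N // p.1 < p.2}

/-- A sample of the quenched disorder: `J (Sum.inl (i, j))` is the coupling `J_{ij}`, `i < j`,
and `J (Sum.inr i)` is the one-body random field `J_i`. -/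
abbrev Disorder (N : ℕ) : Type := (Couple N ⊕ Fin N) → ℝ

/-- The law of the disorder: all the `J_{ij}` and `J_i` are independent centered unit Gaussians. -/
def disorderLaw (N : ℕ) : Measure (Disorder N) := Measure.pi fun _ => gaussianReal 0 1

/-- The exponent of the Boltzmann factor,
`√(t/N) ∑_{(i,j)} J_{ij} σ_i σ_j + b ∑_i σ_i + √x ∑_i J_i σ_i`.
The parameter `b` is the product `β h` of the inverse temperature and the external field. -/
def energy (N : ℕ) (b x t : ℝ) (J : Disorder N) (σ : Config N) : ℝ :=
  √(t / N) * ∑ p : Couple N, J (Sum.inl p) * spin (σ p.1.1) * spin (σ p.1.2)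
    + b * ∑ i, spin (σ i) + √x * ∑ i, J (Sum.inr i) * spin (σ i)

/-- The partition function `Z_N`. -/
def partition (N : ℕ) (b x t : ℝ) (J : Disorder N) : ℝ :=
  ∑ σ : Config N, Real.exp (energy N b x t J σ)

/-- `α_N(x,t) = N⁻¹ E log Z_N`. -/
def alpha (N : ℕ) (b x t : ℝ) : ℝ :=
  (N : ℝ)⁻¹ * ∫ J, Real.log (partition N b x t J) ∂(disorderLaw N)

/-- The order parameter at `t = 0`: `q̄(x₀) = ∫ tanh²(b + z √x₀) dμ(z)`. -/
def qbar (b x₀ : ℝ) : ℝ := ∫ z, Real.tanh (b + z * √x₀) ^ 2 ∂(gaussianReal 0 1)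

/-- `x₀` is the starting point of a trajectory `s ↦ x₀ - q̄(x₀) s` that is at `x` at time `t`. -/
def IsStart (b x t x₀ : ℝ) : Prop := 0 ≤ x₀ ∧ x = x₀ - qbar b x₀ * t

/-- The starting point `x₀(x,t)` of the trajectory through `(x,t)`. The trajectory is unique
except when `b = 0`, `x = 0`, `t > 1`, where besides the trivial `x₀ = 0` there is a
starting point `x₀ > 0`, and the latter is meant; taking the supremum covers all cases. -/
def start (b x t : ℝ) : ℝ := sSup {x₀ | IsStart b x t x₀}

/-- `q̄(x,t) = q̄(x₀(x,t))`. -/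
def qbarAt (b x t : ℝ) : ℝ := qbar b (start b x t)

/-- The replica symmetric Sherrington-Kirkpatrick solution
`ᾱ(x,t) = log 2 + ∫ log cosh(b + z √x₀) dμ(z) + (t/4) (1 - q̄(x₀))²`, with `x₀ = x₀(x,t)`. -/
def alphaBar (b x t : ℝ) : ℝ :=
  Real.log 2 + ∫ z, Real.log (Real.cosh (b + z * √(start b x t))) ∂(gaussianReal 0 1)
    + t / 4 * (1 - qbar b (start b x t)) ^ 2

/-- The overlap of two configurations. -/
def overlap (N : ℕ) (σ τ : Config N) : ℝ := (N : ℝ)⁻¹ * ∑ i, spin (σ i) * spin (τ i)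

/-- The partition function `Z̃_N` of two replicas with the same disorder, coupled by the term
`(lam/2) N (q₁₂ - q̄(x,t))²`. -/
def coupledPartition (N : ℕ) (b x lam t : ℝ) (J : Disorder N) : ℝ :=
  ∑ σ : Config N, ∑ τ : Config N,
    Real.exp (energy N b x t J σ + energy N b x t J τ
      + lam / 2 * N * (overlap N σ τ - qbarAt b x t) ^ 2)

/-- `α̃_N(x,lam,t) = (2N)⁻¹ E log Z̃_N`. -/
def coupledAlpha (N : ℕ) (b x lam t : ℝ) : ℝ :=
  (2 * (N : ℝ))⁻¹ * ∫ J, Real.log (coupledPartition N b x lam t J) ∂(disorderLaw N)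

/-- `Δ_N(x₀,lam₀) = α̃_N(x₀,lam₀,0) - α_N(x₀,0)`. -/
def Delta (N : ℕ) (b x₀ lam₀ : ℝ) : ℝ := coupledAlpha N b x₀ lam₀ 0 - alpha N b x₀ 0

/-- The threshold `λ_c(x₀)`: the supremum of the `r ≥ 0` such that `Δ_N(x₀,lam₀) → 0` as
`N → ∞` for every `0 ≤ lam₀ ≤ r`. -/
def lambdaC (b x₀ : ℝ) : EReal :=
  ⨆ r ∈ {r : ℝ | 0 ≤ r ∧ ∀ lam₀ : ℝ, 0 ≤ lam₀ → lam₀ ≤ r →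
    Tendsto (fun N : ℕ => Delta N b x₀ lam₀) atTop (𝓝 0)}, (r : EReal)

theorem abs_tanh_sq_le (y : ℝ) : |Real.tanh y ^ 2| ≤ 1 := by
  rw [abs_of_nonneg (sq_nonneg _), sq_le_one_iff_abs_le_one]
  exact abs_le.2 ⟨(Real.neg_one_lt_tanh y).le, (Real.tanh_lt_one y).le⟩

theorem continuous_tanh : Continuous Real.tanh := by
  have : Real.tanh = fun y => Real.sinh y / Real.cosh y := funext Real.tanh_eq_sinh_div_cosh
  rw [this]
  exact Real.continuous_sinh.div Real.continuous_cosh fun y => (Real.cosh_pos y).ne'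

theorem continuous_qbar (b : ℝ) : Continuous (qbar b) := by
  unfold qbar
  refine continuous_of_dominated (bound := fun _ => 1) ?_ ?_ (integrable_const _) ?_
  · intro y
    exact ((continuous_tanh.comp (by fun_prop)).pow 2).aestronglyMeasurable
  · intro y
    exact Eventually.of_forall fun z => abs_tanh_sq_le _
  · exact Eventually.of_forall fun z => (continuous_tanh.comp (by fun_prop)).pow 2

theorem qbar_nonneg (b y : ℝ) : 0 ≤ qbar b y := integral_nonneg fun _ => sq_nonneg _

theorem qbar_le_one (b y : ℝ) : qbar b y ≤ 1 := by
  have h := norm_integral_le_of_norm_le_const (μ := gaussianReal 0 1) (C := 1)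
    (f := fun z => Real.tanh (b + z * √y) ^ 2) (Eventually.of_forall fun z => abs_tanh_sq_le _)
  simpa [qbar] using (le_abs_self _).trans h

/-- The starting point is well defined: the equation of the trajectory has a solution, and
`start b x t` is its largest solution (the solution, where it is unique). -/
theorem isGreatest_start (b x t : ℝ) (hx : 0 ≤ x) (ht : 0 ≤ t) :
    IsGreatest {x₀ | IsStart b x t x₀} (start b x t) := by
  have hc : Continuous fun y => y - qbar b y * t :=
    continuous_id.sub ((continuous_qbar b).mul continuous_const)
  have hne : {x₀ | IsStart b x t x₀}.Nonempty := by
    have h := intermediate_value_Icc (a := 0) (b := x + t) (by positivity) hc.continuousOn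
    have hmem : x ∈ Set.Icc (0 - qbar b 0 * t) (x + t - qbar b (x + t) * t) := by
      constructor
      · nlinarith [mul_nonneg (qbar_nonneg b 0) ht]
      · nlinarith [mul_le_mul_of_nonneg_right (qbar_le_one b (x + t)) ht]
    obtain ⟨y, hy, hyx⟩ := h hmem
    exact ⟨y, hy.1, hyx.symm⟩
  have hbd : BddAbove {x₀ | IsStart b x t x₀} := by
    refine ⟨x + t, fun y hy => ?_⟩
    nlinarith [hy.2, mul_le_mul_of_nonneg_right (qbar_le_one b y) ht]
  have hcl : IsClosed {x₀ | IsStart b x t x₀} :=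
    (isClosed_le continuous_const continuous_id).inter (isClosed_eq continuous_const hc)
  exact ⟨hcl.csSup_mem hne hbd, fun y hy => le_csSup hbd hy⟩

end SK

end

/-!
Follow the line `u ↦ (x₀ - q̄(x₀) u, u)` from `(x₀, 0)`, where the spins do not interact, to
`(x, t)`. Gaussian integration by parts shows that the gap `G` between the replica symmetric value
and `α_N` has along this line the derivative `¼ ⟨(q₁₂ - q̄)²⟩`, the average being over two replicas;
so `G` is nonnegative, and it remains to bound the overlap fluctuation. Couple two replicas by
`(lam - u) / 2 * N * (q₁₂ - q̄)²`. Since the coupling decreases at unit speed, it compensates the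
term that the motion along the line contributes for the two replicas together, and what remains
are the overlaps between different pairs, which have a favourable sign. Hence the effect of the
coupling on the free energy per spin is at most `Δ_N(x₀, lam) + G(u)`, and Jensen's inequality
bounds `¼ (lam - u) ⟨(q₁₂ - q̄)²⟩` by it. This says that
`((lam - u) G)' ≤ Δ_N(x₀, lam)`, so `G` vanishes in the limit at every `t < lam` for which
`Δ_N(x₀, lam)` does.
-/

noncomputable section

open scoped NNReal

namespace SK

section GaussianIntegrationByParts

theorem hasDerivAt_gaussianPDFReal (m : ℝ) {v : ℝ≥0} (hv : v ≠ 0) (z : ℝ) :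
    HasDerivAt (gaussianPDFReal m v) (-((z - m) / v * gaussianPDFReal m v z)) z := by
  have hexponent : HasDerivAt (fun y : ℝ => -(y - m) ^ 2 / (2 * v)) (-((z - m) / v)) z := by
    convert! (((hasDerivAt_id z).sub_const m).pow 2).fun_neg.div_const (2 * (v : ℝ)) using 1
    simp [field]
  rw [gaussianPDFReal_def]
  convert! hexponent.exp.const_mul (√(2 * Real.pi * v))⁻¹ using 1
  ring

theorem integrable_gaussianReal_iff {m : ℝ} {v : ℝ≥0} (hv : v ≠ 0) {f : ℝ → ℝ} :
    Integrable f (gaussianReal m v) ↔ Integrable fun z => gaussianPDFReal m v z * f z := by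
  rw [gaussianReal_of_var_ne_zero m hv,
    integrable_withDensity_iff_integrable_smul' (measurable_gaussianPDF m v)
      (Eventually.of_forall fun _ => gaussianPDF_lt_top)]
  simp only [toReal_gaussianPDF, smul_eq_mul]

theorem integral_sub_mul_gaussianReal {m : ℝ} {v : ℝ≥0} {f f' : ℝ → ℝ}
    (hderiv : ∀ z, HasDerivAt f (f' z) z) (hf : Integrable f (gaussianReal m v))
    (hmul : Integrable (fun z => (z - m) * f z) (gaussianReal m v))
    (hf' : Integrable f' (gaussianReal m v)) :
    ∫ z, (z - m) * f z ∂gaussianReal m v = v * ∫ z, f' z ∂gaussianReal m v := by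
  obtain rfl | hv := eq_or_ne v 0
  · simp
  have hv' : (v : ℝ) ≠ 0 := mod_cast hv
  rw [integrable_gaussianReal_iff hv] at hf hmul hf'
  have hparts := integral_mul_deriv_eq_deriv_mul_of_integrable (fun z _ => hderiv z)
    (fun z _ => hasDerivAt_gaussianPDFReal m hv z)
    ((hmul.const_mul (-(v : ℝ)⁻¹)).congr (.of_forall fun z => by simp only [Pi.mul_apply]; ring))
    (hf'.congr (.of_forall fun z => mul_comm _ _)) (hf.congr (.of_forall fun z => mul_comm _ _))
  simp only [integral_gaussianReal_eq_integral_smul hv, smul_eq_mul]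
  calc ∫ z, gaussianPDFReal m v z * ((z - m) * f z)
      = -(v * ∫ z, f z * -((z - m) / v * gaussianPDFReal m v z)) := by
        rw [← integral_const_mul, ← integral_neg]
        congr with z
        field_simp
    _ = v * ∫ z, gaussianPDFReal m v z * f' z := by
        rw [hparts]
        simp only [mul_neg, neg_neg, mul_comm (gaussianPDFReal m v _)]

theorem measurePreserving_update {I : Type*} [Fintype I] [DecidableEq I] {X : I → Type*}
    [∀ i, MeasurableSpace (X i)] (μ : ∀ i, Measure (X i)) [∀ i, IsProbabilityMeasure (μ i)]
    (k : I) :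
    MeasurePreserving (fun p : (∀ i, X i) × X k => Function.update p.1 k p.2)
      ((Measure.pi μ).prod (μ k)) (Measure.pi μ) := by
  refine ⟨measurable_update', (Measure.pi_eq fun s hs => ?_).symm⟩
  have hpreimage : (fun p : (∀ i, X i) × X k => Function.update p.1 k p.2) ⁻¹' Set.univ.pi s
      = (Set.univ.pi (Function.update s k Set.univ)) ×ˢ s k := by
    ext ⟨J, z⟩
    simp only [Set.mem_preimage, Set.mem_prod, Set.mem_pi, Set.mem_univ, true_implies]
    refine ⟨fun h => ⟨fun i => ?_, by simpa using h k⟩, fun h i => ?_⟩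
    all_goals obtain rfl | hi := eq_or_ne i k
    · simp
    · simpa [hi] using h i
    · simpa using h.2
    · simpa [hi] using h.1 i
  rw [Measure.map_apply measurable_update' (MeasurableSet.univ_pi hs), hpreimage,
    Measure.prod_prod, Measure.pi_pi, ← Finset.mul_prod_erase _ _ (Finset.mem_univ k),
    ← Finset.mul_prod_erase _ (fun i => μ i (s i)) (Finset.mem_univ k), Function.update_self,
    measure_univ, one_mul, mul_comm]
  congr 1
  refine Finset.prod_congr rfl fun i hi => ?_
  rw [Function.update_of_ne (Finset.ne_of_mem_erase hi)]

theorem integral_integral_update_pi {I : Type*} [Fintype I] [DecidableEq I] {X : I → Type*}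
    [∀ i, MeasurableSpace (X i)] {μ : ∀ i, Measure (X i)} [∀ i, IsProbabilityMeasure (μ i)]
    {E : Type*} [NormedAddCommGroup E] [NormedSpace ℝ E] (k : I) {g : (∀ i, X i) → E}
    (hg : Integrable g (Measure.pi μ)) :
    ∫ J, ∫ z, g (Function.update J k z) ∂μ k ∂Measure.pi μ = ∫ J, g J ∂Measure.pi μ := by
  have hupdate := measurePreserving_update μ k
  calc ∫ J, ∫ z, g (Function.update J k z) ∂μ k ∂Measure.pi μ
      = ∫ p, g (Function.update p.1 k p.2) ∂(Measure.pi μ).prod (μ k) :=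
        (integral_prod _ (hupdate.integrable_comp_of_integrable hg)).symm
    _ = ∫ J, g J ∂((Measure.pi μ).prod (μ k)).map fun p => Function.update p.1 k p.2 :=
        (integral_map hupdate.aemeasurable
          (hupdate.map_eq.symm ▸ hg.aestronglyMeasurable)).symm
    _ = ∫ J, g J ∂Measure.pi μ := by rw [hupdate.map_eq]

theorem integral_sub_mul_pi_gaussianReal {I : Type*} [Fintype I] [DecidableEq I] {m : I → ℝ}
    {v : I → ℝ≥0} (k : I) {f f' : (I → ℝ) → ℝ}
    (hderiv : ∀ J, HasDerivAt (fun z => f (Function.update J k z)) (f' J) (J k))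
    (hf : Integrable f (Measure.pi fun i => gaussianReal (m i) (v i)))
    (hmul : Integrable (fun J => (J k - m k) * f J)
      (Measure.pi fun i => gaussianReal (m i) (v i)))
    (hf' : Integrable f' (Measure.pi fun i => gaussianReal (m i) (v i))) :
    ∫ J, (J k - m k) * f J ∂(Measure.pi fun i => gaussianReal (m i) (v i))
      = v k * ∫ J, f' J ∂(Measure.pi fun i => gaussianReal (m i) (v i)) := by
  have hupdate := measurePreserving_update (fun i => gaussianReal (m i) (v i)) k
  rw [← integral_integral_update_pi k hmul, ← integral_integral_update_pi k hf',
    ← integral_const_mul]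
  refine integral_congr_ae ?_
  filter_upwards [(hupdate.integrable_comp_of_integrable hf).prod_right_ae,
    (hupdate.integrable_comp_of_integrable hmul).prod_right_ae,
    (hupdate.integrable_comp_of_integrable hf').prod_right_ae] with J hfJ hmulJ hfJ'
  simp only [Function.comp_apply, Function.update_self] at hfJ hmulJ hfJ' ⊢
  exact integral_sub_mul_gaussianReal
    (fun z => by simpa using hderiv (Function.update J k z)) hfJ hmulJ hfJ'

end GaussianIntegrationByParts

section Gibbs

variable {A : Type*} [Fintype A]

/-- The partition function of the exponent `H`, in the sign convention of `SK.energy`: the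
Boltzmann weight of `a` is `exp (H a)`. -/
def gibbsZ (H : A → ℝ) : ℝ := ∑ a, Real.exp (H a)

/-- The expectation with respect to the Gibbs measure of the exponent `H`, as a linear functional
of the observable. -/
def gibbsAvg (H : A → ℝ) : (A → ℝ) →L[ℝ] ℝ :=
  (gibbsZ H)⁻¹ • ∑ a, Real.exp (H a) • ContinuousLinearMap.proj a

theorem gibbsAvg_apply (H f : A → ℝ) :
    gibbsAvg H f = (gibbsZ H)⁻¹ * ∑ a, Real.exp (H a) * f a := by
  simp [gibbsAvg]

theorem gibbsZ_add_prod {B : Type*} [Fintype B] (H : A → ℝ) (K : B → ℝ) :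
    gibbsZ (fun p : A × B => H p.1 + K p.2) = gibbsZ H * gibbsZ K := by
  simp only [gibbsZ, Real.exp_add, Fintype.sum_prod_type, Finset.sum_mul_sum]

theorem gibbsAvg_add_prod {B : Type*} [Fintype B] (H f : A → ℝ) (K g : B → ℝ) :
    gibbsAvg (fun p : A × B => H p.1 + K p.2) (fun p => f p.1 * g p.2)
      = gibbsAvg H f * gibbsAvg K g := by
  simp only [gibbsAvg_apply, gibbsZ_add_prod, mul_inv, Real.exp_add, Fintype.sum_prod_type,
    mul_mul_mul_comm _ _ (f _), ← Finset.sum_mul_sum]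
  ring

variable [Nonempty A]

theorem gibbsZ_pos (H : A → ℝ) : 0 < gibbsZ H :=
  Finset.sum_pos (fun _ _ => Real.exp_pos _) Finset.univ_nonempty

theorem gibbsAvg_const (H : A → ℝ) (r : ℝ) : gibbsAvg H (fun _ => r) = r := by
  rw [gibbsAvg_apply, ← Finset.sum_mul]
  exact inv_mul_cancel_left₀ (gibbsZ_pos H).ne' r

theorem gibbsAvg_mono (H : A → ℝ) : Monotone (gibbsAvg H) := by
  intro f g hfg
  have hZ := gibbsZ_pos H
  rw [gibbsAvg_apply, gibbsAvg_apply]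
  gcongr with a
  exact hfg a

theorem abs_gibbsAvg_le (H f : A → ℝ) : |gibbsAvg H f| ≤ ‖f‖ := by
  rw [abs_le]
  have hcoord (a : A) : |f a| ≤ ‖f‖ := norm_le_pi_norm f a
  constructor
  · rw [← gibbsAvg_const H (-‖f‖)]
    exact gibbsAvg_mono H fun a => (abs_le.1 (hcoord a)).1
  · rw [← gibbsAvg_const H ‖f‖]
    exact gibbsAvg_mono H fun a => (abs_le.1 (hcoord a)).2

theorem norm_gibbsAvg_le (H : A → ℝ) : ‖gibbsAvg H‖ ≤ 1 :=
  (gibbsAvg H).opNorm_le_bound zero_le_one fun f => by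
    simpa only [one_mul] using! abs_gibbsAvg_le H f

theorem continuous_gibbsAvg : Continuous (gibbsAvg : (A → ℝ) → (A → ℝ) →L[ℝ] ℝ) := by
  have hZ : Continuous (gibbsZ : (A → ℝ) → ℝ) := by
    unfold gibbsZ
    fun_prop
  unfold gibbsAvg
  exact (hZ.inv₀ fun H => (gibbsZ_pos H).ne').smul (by fun_prop)

theorem hasFDerivAt_log_gibbsZ (H : A → ℝ) :
    HasFDerivAt (fun H : A → ℝ => Real.log (gibbsZ H)) (gibbsAvg H) H := by
  have hZ : HasFDerivAt gibbsZ (∑ a, Real.exp (H a) • ContinuousLinearMap.proj (R := ℝ) a) H :=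
    HasFDerivAt.fun_sum fun a _ =>
      (ContinuousLinearMap.proj (R := ℝ) (φ := fun _ : A => ℝ) a).hasFDerivAt.exp
  exact hZ.log (gibbsZ_pos H).ne'

theorem hasDerivAt_gibbsAvg {H : ℝ → A → ℝ} {H' : A → ℝ} {s : ℝ} (hH : HasDerivAt H H' s)
    (f : A → ℝ) :
    HasDerivAt (fun u => gibbsAvg (H u) f)
      (gibbsAvg (H s) (f * H') - gibbsAvg (H s) f * gibbsAvg (H s) H') s := by
  have hexp (a : A) := ((hasDerivAt_pi.1 hH) a).exp
  have hZ := HasDerivAt.fun_sum (u := Finset.univ) fun a _ => hexp a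
  have hnum := HasDerivAt.fun_sum (u := Finset.univ) fun a _ => (hexp a).mul_const (f a)
  simp only [gibbsAvg_apply]
  refine ((hZ.fun_inv (gibbsZ_pos (H s)).ne').fun_mul hnum).congr_deriv ?_
  change -_ / gibbsZ (H s) ^ 2 * _ + (gibbsZ (H s))⁻¹ * _ = _
  have hne := (gibbsZ_pos (H s)).ne'
  field_simp
  simp only [Pi.mul_apply, mul_right_comm _ (H' _) (f _), mul_assoc]
  ring

theorem exp_gibbsAvg_le (H g : A → ℝ) :
    Real.exp (gibbsAvg H g) ≤ (gibbsZ H)⁻¹ * gibbsZ (H + g) := by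
  have hZ := gibbsZ_pos H
  have hJensen := convexOn_exp.map_sum_le (t := Finset.univ)
    (w := fun a => (gibbsZ H)⁻¹ * Real.exp (H a)) (p := g) (fun _ _ => by positivity)
    (by rw [← Finset.mul_sum]; exact inv_mul_cancel₀ hZ.ne') (fun _ _ => Set.mem_univ _)
  simp only [smul_eq_mul, mul_assoc, ← Real.exp_add, ← Finset.mul_sum] at hJensen
  rwa [gibbsAvg_apply]

theorem gibbsAvg_le_log_gibbsZ_sub (H g : A → ℝ) :
    gibbsAvg H g ≤ Real.log (gibbsZ (H + g)) - Real.log (gibbsZ H) := by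
  have hlog := Real.log_le_log (Real.exp_pos _) (exp_gibbsAvg_le H g)
  rw [Real.log_exp, Real.log_mul (inv_ne_zero (gibbsZ_pos H).ne') (gibbsZ_pos _).ne',
    Real.log_inv] at hlog
  linarith

theorem abs_log_gibbsZ_sub_le (H K : A → ℝ) :
    |Real.log (gibbsZ H) - Real.log (gibbsZ K)| ≤ ‖H - K‖ := by
  have hupper (H K : A → ℝ) : Real.log (gibbsZ K) - Real.log (gibbsZ H) ≤ ‖H - K‖ := by
    have hJensen := gibbsAvg_le_log_gibbsZ_sub K (H - K)
    have hbound := neg_le_of_abs_le (abs_gibbsAvg_le K (H - K))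
    rw [add_sub_cancel] at hJensen
    linarith
  rw [abs_sub_le_iff]
  exact ⟨norm_sub_rev H K ▸ hupper K H, hupper H K⟩

theorem gibbsAvg_covariance (H f g : A → ℝ) :
    gibbsAvg H (f * g) - gibbsAvg H f * gibbsAvg H g
      = gibbsAvg (fun p : A × A => H p.1 + H p.2) (fun p => f p.1 * g p.1 - f p.1 * g p.2) := by
  have hdiag := gibbsAvg_add_prod H (f * g) H (fun _ => 1)
  rw [gibbsAvg_const, mul_one] at hdiag
  rw [← hdiag, ← gibbsAvg_add_prod, ← map_sub]
  simp [Pi.sub_def]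

end Gibbs

section GaussianHamiltonian

variable {A I : Type*} [Fintype I]

/-- The law of a family of independent standard Gaussian variables indexed by `I`; it is
`SK.disorderLaw` for a general index set. -/
abbrev stdGaussianPi (I : Type*) [Fintype I] : Measure (I → ℝ) :=
  Measure.pi fun _ => gaussianReal 0 1

/-- The Gaussian Hamiltonian `σ ↦ h σ + ∑ k, J k * (c k * a σ k)` with patterns `a` and
disorder `J`, as a linear function of the pair `(c, h)` of its amplitudes and its deterministic
part, the variables in which the free energy is differentiated. -/
def ham (a : A → I → ℝ) (J : I → ℝ) : (I → ℝ) × (A → ℝ) →L[ℝ] (A → ℝ) :=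
  .snd ℝ (I → ℝ) (A → ℝ) + ∑ k, J k •
    ((ContinuousLinearMap.proj (R := ℝ) (φ := fun _ : I => ℝ) k).comp
      (.fst ℝ (I → ℝ) (A → ℝ))).smulRight (fun σ => a σ k)

/-- The covariance of the centered Gaussian field `∑ k, √(w k) * J k * a σ k`, extended to
weights `w` of any sign. -/
def cov (w : I → ℝ) (a : A → I → ℝ) (σ τ : A) : ℝ := ∑ k, w k * (a σ k * a τ k)

theorem ham_apply (a : A → I → ℝ) (J : I → ℝ) (θ : (I → ℝ) × (A → ℝ)) (σ : A) :
    ham a J θ σ = θ.2 σ + ∑ k, J k * (θ.1 k * a σ k) := by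
  simp [ham]

theorem hasDerivAt_ham_update [DecidableEq I] [Finite A] (a : A → I → ℝ)
    (θ : (I → ℝ) × (A → ℝ)) (J : I → ℝ) (k : I) :
    HasDerivAt (fun z => ham a (Function.update J k z) θ) (fun σ => θ.1 k * a σ k) (J k) := by
  have := Fintype.ofFinite A
  refine hasDerivAt_pi.2 fun σ => ?_
  simp only [ham_apply]
  have hsum := HasDerivAt.fun_sum (u := Finset.univ) fun i _ =>
    ((hasDerivAt_pi.1 (hasDerivAt_update J k (J k))) i).mul_const (θ.1 i * a σ i)
  refine (hsum.const_add (θ.2 σ)).congr_deriv ?_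
  simp [Pi.single_apply]

theorem integrable_eval_stdGaussianPi (k : I) :
    Integrable (fun J : I → ℝ => J k) (stdGaussianPi I) :=
  integrable_comp_eval (μ := fun _ : I => gaussianReal 0 1) (i := k) (f := fun z : ℝ => z)
    (memLp_one_iff_integrable.1 (memLp_id_gaussianReal 1))

theorem continuous_ham (a : A → I → ℝ) : Continuous (ham a) := by
  unfold ham
  fun_prop

theorem integrable_add_sum_eval_smul {E : Type*} [NormedAddCommGroup E] [NormedSpace ℝ E]
    (y : E) (x : I → E) : Integrable (fun J : I → ℝ => y + ∑ k, J k • x k) (stdGaussianPi I) :=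
  (integrable_const y).add
    (integrable_finsetSum _ fun k _ => (integrable_eval_stdGaussianPi k).smul_const (x k))

theorem integrable_ham [Fintype A] (a : A → I → ℝ) : Integrable (ham a) (stdGaussianPi I) :=
  integrable_add_sum_eval_smul _ _

variable [Fintype A] (a : A → I → ℝ) (θ : (I → ℝ) × (A → ℝ))

/-- The quenched free energy `E log Z` of the Hamiltonian `ham`, without the usual division by
the size of the system. -/
def freeEnergy : ℝ := ∫ J, Real.log (gibbsZ (ham a J θ)) ∂stdGaussianPi I

/-- The average over the disorder of the expectation of a function of two replicas, that is,
of two independent configurations sampled from the same Gibbs measure. -/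
def quenchedAvg : (A × A → ℝ) →L[ℝ] ℝ :=
  ∫ J, gibbsAvg (fun p : A × A => ham a J θ p.1 + ham a J θ p.2) ∂stdGaussianPi I

variable [Nonempty A]

theorem integrable_log_gibbsZ_ham :
    Integrable (fun J => Real.log (gibbsZ (ham a J θ))) (stdGaussianPi I) := by
  have hcont : Continuous fun J => Real.log (gibbsZ (ham a J θ)) :=
    (continuous_iff_continuousAt.2 fun H : A → ℝ =>
      (hasFDerivAt_log_gibbsZ H).continuousAt).comp ((continuous_ham a).clm_apply continuous_const)
  refine (((integrable_ham a).norm.mul_const ‖θ‖).add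
    (integrable_const |Real.log (gibbsZ (0 : A → ℝ))|)).mono' hcont.aestronglyMeasurable
    (.of_forall fun J => ?_)
  calc ‖Real.log (gibbsZ (ham a J θ))‖
      ≤ |Real.log (gibbsZ (ham a J θ)) - Real.log (gibbsZ (0 : A → ℝ))|
        + |Real.log (gibbsZ (0 : A → ℝ))| := by
        simpa using abs_add_le (Real.log (gibbsZ (ham a J θ)) - Real.log (gibbsZ (0 : A → ℝ)))
          (Real.log (gibbsZ (0 : A → ℝ)))
    _ ≤ ‖ham a J‖ * ‖θ‖ + |Real.log (gibbsZ (0 : A → ℝ))| := by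
        gcongr
        exact (abs_log_gibbsZ_sub_le _ _).trans (by simpa using (ham a J).le_opNorm θ)

theorem integrable_gibbsAvg_ham (f : A → ℝ) :
    Integrable (fun J => gibbsAvg (ham a J θ) f) (stdGaussianPi I) := by
  have hcont : Continuous fun J => gibbsAvg (ham a J θ) f :=
    (continuous_gibbsAvg.comp ((continuous_ham a).clm_apply continuous_const)).clm_apply
      continuous_const
  exact .of_bound hcont.aestronglyMeasurable ‖f‖
    (.of_forall fun J => abs_gibbsAvg_le _ f)

theorem integrable_gibbsAvg_replica : Integrable
    (fun J => gibbsAvg fun p : A × A => ham a J θ p.1 + ham a J θ p.2) (stdGaussianPi I) := by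
  have hham : Continuous fun J => ham a J θ := (continuous_ham a).clm_apply continuous_const
  have hcont : Continuous fun J => gibbsAvg fun p : A × A => ham a J θ p.1 + ham a J θ p.2 :=
    continuous_gibbsAvg.comp (by fun_prop)
  exact .of_bound hcont.aestronglyMeasurable 1 (.of_forall fun J => norm_gibbsAvg_le _)

theorem quenchedAvg_apply (f : A × A → ℝ) :
    quenchedAvg a θ f
      = ∫ J, gibbsAvg (fun p : A × A => ham a J θ p.1 + ham a J θ p.2) f ∂stdGaussianPi I :=
  ContinuousLinearMap.integral_apply (integrable_gibbsAvg_replica a θ) f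

theorem quenchedAvg_mono : Monotone (quenchedAvg a θ) := by
  intro f g hfg
  rw [quenchedAvg_apply, quenchedAvg_apply]
  exact integral_mono ((integrable_gibbsAvg_replica a θ).apply_continuousLinearMap f)
    ((integrable_gibbsAvg_replica a θ).apply_continuousLinearMap g)
    fun J => gibbsAvg_mono _ hfg

theorem quenchedAvg_const (r : ℝ) : quenchedAvg a θ (fun _ => r) = r := by
  simp [quenchedAvg_apply, gibbsAvg_const]

theorem quenchedAvg_comp_fst (f : A → ℝ) :
    quenchedAvg a θ (fun p => f p.1) = ∫ J, gibbsAvg (ham a J θ) f ∂stdGaussianPi I := by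
  rw [quenchedAvg_apply]
  congr with J
  have hprod := gibbsAvg_add_prod (ham a J θ) f (ham a J θ) fun _ => 1
  simpa only [gibbsAvg_const, mul_one] using hprod

theorem integrable_mul_gibbsAvg_ham (k : I) (f : A → ℝ) :
    Integrable (fun J => J k * gibbsAvg (ham a J θ) f) (stdGaussianPi I) :=
  (integrable_eval_stdGaussianPi k).mul_bdd (integrable_gibbsAvg_ham a θ f).aestronglyMeasurable
    (.of_forall fun J => abs_gibbsAvg_le (ham a J θ) f)

theorem integral_mul_gibbsAvg_ham (k : I) (f : A → ℝ) :
    ∫ J, J k * gibbsAvg (ham a J θ) f ∂stdGaussianPi I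
      = θ.1 k * quenchedAvg a θ (fun p => f p.1 * a p.1 k - f p.1 * a p.2 k) := by
  classical
  have hderiv (J : I → ℝ) :
      HasDerivAt (fun z => gibbsAvg (ham a (Function.update J k z) θ) f)
        (θ.1 k * gibbsAvg (fun p : A × A => ham a J θ p.1 + ham a J θ p.2)
          (fun p => f p.1 * a p.1 k - f p.1 * a p.2 k)) (J k) := by
    refine (hasDerivAt_gibbsAvg (hasDerivAt_ham_update a θ J k) f).congr_deriv ?_
    rw [Function.update_eq_self, gibbsAvg_covariance, ← smul_eq_mul, ← map_smul]
    congr 1 with p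
    simp only [Pi.smul_apply, smul_eq_mul]
    ring
  have hstein := integral_sub_mul_pi_gaussianReal k hderiv (integrable_gibbsAvg_ham a θ f)
    (by simpa only [sub_zero] using integrable_mul_gibbsAvg_ham a θ k f)
    (((integrable_gibbsAvg_replica a θ).apply_continuousLinearMap _).const_mul _)
  simpa only [sub_zero, NNReal.coe_one, one_mul, integral_const_mul, quenchedAvg_apply]
    using hstein

theorem aestronglyMeasurable_fderiv_log_gibbsZ_ham : AEStronglyMeasurable
    (fun J => (gibbsAvg (ham a J θ)).comp (ham a J)) (stdGaussianPi I) :=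
  ((continuous_gibbsAvg.comp ((continuous_ham a).clm_apply continuous_const)).clm_comp
    (continuous_ham a)).aestronglyMeasurable

theorem norm_fderiv_log_gibbsZ_ham_le (J : I → ℝ) :
    ‖(gibbsAvg (ham a J θ)).comp (ham a J)‖ ≤ ‖ham a J‖ :=
  (ContinuousLinearMap.opNorm_comp_le _ _).trans
    (mul_le_of_le_one_left (norm_nonneg _) (norm_gibbsAvg_le _))

theorem hasFDerivAt_freeEnergy :
    HasFDerivAt (freeEnergy a)
      (∫ J, (gibbsAvg (ham a J θ)).comp (ham a J) ∂stdGaussianPi I) θ :=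
  hasFDerivAt_integral_of_dominated_of_fderiv_le univ_mem
    (.of_forall fun ξ => (integrable_log_gibbsZ_ham a ξ).aestronglyMeasurable)
    (integrable_log_gibbsZ_ham a θ) (aestronglyMeasurable_fderiv_log_gibbsZ_ham a θ)
    (.of_forall fun J ξ _ => norm_fderiv_log_gibbsZ_ham_le a ξ J) (integrable_ham a).norm
    (.of_forall fun J ξ _ => (hasFDerivAt_log_gibbsZ (ham a J ξ)).comp ξ (ham a J).hasFDerivAt)

theorem integral_gibbsAvg_comp_ham_apply (ξ : (I → ℝ) × (A → ℝ)) :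
    (∫ J, (gibbsAvg (ham a J θ)).comp (ham a J) ∂stdGaussianPi I) ξ
      = quenchedAvg a θ fun p => ξ.2 p.1 + (cov (θ.1 * ξ.1) a p.1 p.1
        - cov (θ.1 * ξ.1) a p.1 p.2) := by
  have hint : Integrable (fun J => (gibbsAvg (ham a J θ)).comp (ham a J))
      (stdGaussianPi I) :=
    (integrable_ham a).mono (aestronglyMeasurable_fderiv_log_gibbsZ_ham a θ)
      (.of_forall (norm_fderiv_log_gibbsZ_ham_le a θ))
  have hham (J : I → ℝ) : ham a J ξ = ξ.2 + ∑ k, (J k * ξ.1 k) • fun σ => a σ k := by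
    ext σ
    simp [ham_apply, mul_assoc]
  calc (∫ J, (gibbsAvg (ham a J θ)).comp (ham a J) ∂stdGaussianPi I) ξ
      = ∫ J, (gibbsAvg (ham a J θ) ξ.2
          + ∑ k, ξ.1 k * (J k * gibbsAvg (ham a J θ) fun σ => a σ k)) ∂stdGaussianPi I := by
        rw [ContinuousLinearMap.integral_apply hint]
        congr with J
        simp only [ContinuousLinearMap.comp_apply, hham, map_add, map_sum, map_smul, smul_eq_mul]
        congr 1
        exact Finset.sum_congr rfl fun k _ => by ring
    _ = quenchedAvg a θ (fun p => ξ.2 p.1)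
          + ∑ k, ξ.1 k * (θ.1 k
            * quenchedAvg a θ fun p => a p.1 k * a p.1 k - a p.1 k * a p.2 k) := by
        rw [integral_add (integrable_gibbsAvg_ham a θ ξ.2) (integrable_finsetSum _ fun k _ =>
            (integrable_mul_gibbsAvg_ham a θ k _).const_mul _),
          integral_finsetSum _ fun k _ => (integrable_mul_gibbsAvg_ham a θ k _).const_mul _]
        simp only [integral_const_mul, integral_mul_gibbsAvg_ham, quenchedAvg_comp_fst]
    _ = quenchedAvg a θ fun p => ξ.2 p.1 + (cov (θ.1 * ξ.1) a p.1 p.1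
          - cov (θ.1 * ξ.1) a p.1 p.2) := by
        simp only [← smul_eq_mul, ← map_smul, ← map_sum, ← map_add]
        congr 1 with p
        simp only [cov, Pi.add_apply, Finset.sum_apply, Pi.smul_apply, Pi.mul_apply, smul_eq_mul,
          ← Finset.sum_sub_distrib]
        congr 1
        exact Finset.sum_congr rfl fun k _ => by ring

theorem hasDerivAt_freeEnergy {θ : ℝ → (I → ℝ) × (A → ℝ)} {θ' : (I → ℝ) × (A → ℝ)} {s : ℝ}
    (hθ : HasDerivAt θ θ' s) :
    HasDerivAt (fun u => freeEnergy a (θ u))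
      (quenchedAvg a (θ s) fun p => θ'.2 p.1 + (cov ((θ s).1 * θ'.1) a p.1 p.1
        - cov ((θ s).1 * θ'.1) a p.1 p.2)) s :=
  ((hasFDerivAt_freeEnergy a (θ s)).comp_hasDerivAt s hθ).congr_deriv
    (integral_gibbsAvg_comp_ham_apply a (θ s) θ')

end GaussianHamiltonian

section Interpolation

theorem hasDerivAt_sqrt_add_mul {v w T s : ℝ} (hv : 0 ≤ v) (hvT : 0 ≤ v + T * w)
    (hs : s ∈ Set.Ioo 0 T) :
    HasDerivAt (fun u => √(v + u * w)) (w / (2 * √(v + s * w))) s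
      ∧ √(v + s * w) * (w / (2 * √(v + s * w))) = w / 2 := by
  obtain rfl | hw := eq_or_ne w 0
  · simpa using hasDerivAt_const s (√v)
  have hpos : 0 < v + s * w := by
    obtain hw | hw := hw.lt_or_gt
    · nlinarith [hs.2]
    · nlinarith [hs.1]
  have hsqrt : √(v + s * w) ≠ 0 := (Real.sqrt_pos.2 hpos).ne'
  exact ⟨by simpa using (((hasDerivAt_id s).mul_const w).const_add v).sqrt hpos.ne',
    by field_simp⟩

variable {A I : Type*} [Fintype A]

/-- The amplitudes of the Gaussian Hamiltonian whose covariance has the weights `v + u * w`. -/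
def amplitude (v w : I → ℝ) (u : ℝ) : I → ℝ := fun k => √(v k + u * w k)

theorem continuous_amplitude (v w : I → ℝ) : Continuous (amplitude v w) := by
  unfold amplitude
  fun_prop

variable [Fintype I] [Nonempty A] (a : A → I → ℝ)

theorem continuous_freeEnergy : Continuous (freeEnergy a) :=
  continuous_iff_continuousAt.2 fun θ => (hasFDerivAt_freeEnergy a θ).continuousAt

theorem hasDerivAt_freeEnergy_amplitude {v w : I → ℝ} (hv : 0 ≤ v) {T : ℝ}
    (hvT : 0 ≤ v + T • w) {s : ℝ} (hs : s ∈ Set.Ioo 0 T) {h : ℝ → A → ℝ} {h' : A → ℝ}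
    (hh : HasDerivAt h h' s) :
    HasDerivAt (fun u => freeEnergy a (amplitude v w u, h u))
      (quenchedAvg a (amplitude v w s, h s)
        fun p => h' p.1 + (cov w a p.1 p.1 - cov w a p.1 p.2) / 2) s := by
  have hsqrt (k : I) := hasDerivAt_sqrt_add_mul (hv k) (hvT k) hs
  have hamplitude : HasDerivAt (amplitude v w)
      (fun k => w k / (2 * √(v k + s * w k))) s := hasDerivAt_pi.2 fun k => (hsqrt k).1
  refine (hasDerivAt_freeEnergy a (hamplitude.prodMk hh)).congr_deriv ?_
  have hweight : (amplitude v w s * fun k => w k / (2 * √(v k + s * w k))) = fun k => w k / 2 :=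
    funext fun k => (hsqrt k).2
  simp only [hweight, cov, div_mul_eq_mul_div, ← Finset.sum_div, sub_div]

end Interpolation

section ReplicaCoupling

variable {A I : Type*} [Fintype I]

/-- `D` measures the distance of two replicas in such a way that, up to the constant `C`, it is
the covariance of the Gaussian field with patterns `a` and weights `w`; `d` is its value on equal
replicas. In the Sherrington-Kirkpatrick model `D` is `N / 2 * (q₁₂ - q̄) ^ 2`. -/
structure IsReplicaCoupling (w : I → ℝ) (a : A → I → ℝ) (D : A × A → ℝ) (C d : ℝ) : Prop where
  nonneg (p : A × A) : 0 ≤ D p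
  cov_eq (σ τ : A) : cov w a σ τ = D (σ, τ) - C
  diag (σ : A) : D (σ, σ) = d

/-- The patterns of two replicas subject to the same disorder. -/
def pairPattern (a : A → I → ℝ) : A × A → I → ℝ := fun p => a p.1 + a p.2

theorem cov_pairPattern (w : I → ℝ) (a : A → I → ℝ) (p q : A × A) :
    cov w (pairPattern a) p q
      = cov w a p.1 q.1 + cov w a p.1 q.2 + cov w a p.2 q.1 + cov w a p.2 q.2 := by
  simp only [cov, ← Finset.sum_add_distrib, pairPattern, Pi.add_apply]
  exact Finset.sum_congr rfl fun k _ => by ring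

theorem cov_comm (w : I → ℝ) (a : A → I → ℝ) (σ τ : A) : cov w a σ τ = cov w a τ σ := by
  simp only [cov, mul_comm (a σ _)]

theorem ham_pairPattern (a : A → I → ℝ) (J : I → ℝ) (θ : (I → ℝ) × (A → ℝ)) (f : A × A → ℝ) :
    ham (pairPattern a) J (θ.1, fun p => θ.2 p.1 + θ.2 p.2 + f p)
      = (fun p => ham a J θ p.1 + ham a J θ p.2) + f := by
  ext p
  simp only [ham_apply, pairPattern, Pi.add_apply, mul_add, Finset.sum_add_distrib]
  ring

theorem IsReplicaCoupling.cov_pairPattern_sub_le {w : I → ℝ} {a : A → I → ℝ}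
    {D : A × A → ℝ} {C d : ℝ} (hD : IsReplicaCoupling w a D C d) (p q : A × A) :
    (cov w (pairPattern a) p p - cov w (pairPattern a) p q) / 2 ≤ d + D p := by
  simp only [cov_pairPattern, cov_comm w a p.2 p.1, hD.cov_eq, hD.diag]
  linarith [hD.nonneg (p.1, q.1), hD.nonneg (p.1, q.2), hD.nonneg (p.2, q.1),
    hD.nonneg (p.2, q.2)]

variable [Fintype A]

/-- The free energy of two replicas subject to the same disorder, whose joint Boltzmann weight
carries the additional factor `exp (f p)`. -/
def coupledFreeEnergy (a : A → I → ℝ) (θ : (I → ℝ) × (A → ℝ)) (f : A × A → ℝ) : ℝ :=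
  freeEnergy (pairPattern a) (θ.1, fun p => θ.2 p.1 + θ.2 p.2 + f p)

/-- The amount by which the free energy at time `u` falls short of its linear extrapolation with
slope `d / 2`. -/
def gap (a : A → I → ℝ) (v w : I → ℝ) (h : A → ℝ) (d u : ℝ) : ℝ :=
  freeEnergy a (amplitude v w 0, h) + u * (d / 2) - freeEnergy a (amplitude v w u, h)

variable [Nonempty A]

theorem quenchedAvg_le_coupledFreeEnergy_sub (a : A → I → ℝ) (θ : (I → ℝ) × (A → ℝ))
    (f : A × A → ℝ) :
    quenchedAvg a θ f ≤ coupledFreeEnergy a θ f - 2 * freeEnergy a θ := by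
  have hint := integrable_log_gibbsZ_ham (pairPattern a) (θ.1, fun p => θ.2 p.1 + θ.2 p.2 + f p)
  have hint₀ := (integrable_log_gibbsZ_ham a θ).const_mul 2
  rw [quenchedAvg_apply, coupledFreeEnergy, freeEnergy, freeEnergy, ← integral_const_mul,
    ← integral_sub hint hint₀]
  refine integral_mono ((integrable_gibbsAvg_replica a θ).apply_continuousLinearMap f)
    (hint.sub hint₀) fun J => (gibbsAvg_le_log_gibbsZ_sub _ _).trans_eq ?_
  rw [ham_pairPattern, gibbsZ_add_prod, Real.log_mul (gibbsZ_pos _).ne' (gibbsZ_pos _).ne',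
    two_mul]

variable {a : A → I → ℝ} {v w : I → ℝ} {h : A → ℝ} {D : A × A → ℝ} {C d T : ℝ}

theorem continuous_gap : Continuous (gap a v w h d) := by
  unfold gap
  have hamplitude := continuous_amplitude v w
  exact (by fun_prop : Continuous fun u => freeEnergy a (amplitude v w 0, h) + u * (d / 2)).sub
    ((continuous_freeEnergy a).comp (by fun_prop))

theorem IsReplicaCoupling.hasDerivAt_gap (hD : IsReplicaCoupling w a D C d) (hv : 0 ≤ v)
    (hvT : 0 ≤ v + T • w) {s : ℝ} (hs : s ∈ Set.Ioo 0 T) :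
    HasDerivAt (gap a v w h d) (quenchedAvg a (amplitude v w s, h) D / 2) s := by
  have hfree := hasDerivAt_freeEnergy_amplitude a hv hvT hs (hasDerivAt_const s h)
  refine ((((hasDerivAt_id s).mul_const (d / 2)).const_add _).sub hfree).congr_deriv ?_
  have hreplica : (fun p : A × A => (0 : A → ℝ) p.1 + (cov w a p.1 p.1 - cov w a p.1 p.2) / 2)
      = (fun _ => d / 2) - (2⁻¹ : ℝ) • D := by
    ext p
    simp only [hD.cov_eq, hD.diag, Pi.zero_apply, Pi.sub_apply, Pi.smul_apply, smul_eq_mul]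
    ring
  rw [hreplica, map_sub, map_smul, quenchedAvg_const, smul_eq_mul]
  ring

theorem IsReplicaCoupling.quenchedAvg_nonneg (hD : IsReplicaCoupling w a D C d)
    (θ : (I → ℝ) × (A → ℝ)) : 0 ≤ quenchedAvg a θ D := by
  rw [← quenchedAvg_const a θ 0]
  exact quenchedAvg_mono a θ hD.nonneg

theorem IsReplicaCoupling.gap_nonneg (hD : IsReplicaCoupling w a D C d) (hv : 0 ≤ v)
    (hvT : 0 ≤ v + T • w) (hT : 0 ≤ T) : 0 ≤ gap a v w h d T := by
  have hmono : MonotoneOn (gap a v w h d) (Set.Icc 0 T) := by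
    refine monotoneOn_of_hasDerivWithinAt_nonneg (convex_Icc 0 T) continuous_gap.continuousOn
      (fun s hs => (hD.hasDerivAt_gap hv hvT (by rwa [interior_Icc] at hs)).hasDerivWithinAt)
      fun s _ => ?_
    have := hD.quenchedAvg_nonneg (amplitude v w s, h)
    positivity
  simpa [gap] using hmono (Set.left_mem_Icc.2 hT) (Set.right_mem_Icc.2 hT) hT

theorem IsReplicaCoupling.gap_le_add (hD : IsReplicaCoupling w a D C d) {B : ℝ}
    (hB : ∀ p, D p ≤ B) (hv : 0 ≤ v) (hvT : 0 ≤ v + T • w) {s : ℝ} (hs : s ∈ Set.Icc 0 T) :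
    gap a v w h d T ≤ gap a v w h d s + (T - s) * (B / 2) := by
  have hanti : AntitoneOn (fun u => gap a v w h d u - u * (B / 2)) (Set.Icc 0 T) := by
    refine antitoneOn_of_hasDerivWithinAt_nonpos (convex_Icc 0 T)
      (continuous_gap.sub (by fun_prop)).continuousOn (fun s hs =>
        ((hD.hasDerivAt_gap hv hvT (by rwa [interior_Icc] at hs)).sub
          ((hasDerivAt_id s).mul_const (B / 2))).hasDerivWithinAt) fun s _ => ?_
    have hbound : quenchedAvg a (amplitude v w s, h) D ≤ B := by
      rw [← quenchedAvg_const a (amplitude v w s, h) B]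
      exact quenchedAvg_mono a _ hB
    linarith
  have := hanti hs (Set.right_mem_Icc.2 (hs.1.trans hs.2)) hs.2
  linarith

theorem IsReplicaCoupling.coupledFreeEnergy_le (hD : IsReplicaCoupling w a D C d) (hv : 0 ≤ v)
    (hvT : 0 ≤ v + T • w) (lam : ℝ) {s : ℝ} (hs : s ∈ Set.Icc 0 T) :
    coupledFreeEnergy a (amplitude v w s, h) ((lam - s) • D)
      ≤ coupledFreeEnergy a (amplitude v w 0, h) (lam • D) + s * d := by
  have hfield (s : ℝ) : HasDerivAt (fun u p => h p.1 + h p.2 + ((lam - u) • D) p) (-D) s := by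
    refine hasDerivAt_pi.2 fun p => ?_
    simpa using (((hasDerivAt_id s).const_sub lam).mul_const (D p)).const_add (h p.1 + h p.2)
  have hfield_cont := continuous_iff_continuousAt.2 fun s => (hfield s).continuousAt
  have hanti : AntitoneOn
      (fun u => coupledFreeEnergy a (amplitude v w u, h) ((lam - u) • D) - u * d)
      (Set.Icc 0 T) := by
    refine antitoneOn_of_hasDerivWithinAt_nonpos (convex_Icc 0 T)
      (((continuous_freeEnergy (pairPattern a)).comp
        ((continuous_amplitude v w).prodMk hfield_cont)).sub (by fun_prop)).continuousOn
      (fun s hs => ((hasDerivAt_freeEnergy_amplitude (pairPattern a) hv hvT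
        (by rwa [interior_Icc] at hs) (hfield s)).sub
          ((hasDerivAt_id s).mul_const d)).hasDerivWithinAt) fun s _ => ?_
    rw [one_mul, sub_nonpos, ← quenchedAvg_const (pairPattern a)
      (amplitude v w s, fun p => h p.1 + h p.2 + ((lam - s) • D) p) d]
    refine quenchedAvg_mono _ _ fun p => ?_
    simp only [Pi.neg_apply]
    linarith [hD.cov_pairPattern_sub_le p.1 p.2]
  have := hanti (Set.left_mem_Icc.2 (hs.1.trans hs.2)) hs hs.1
  simp only [sub_zero, zero_mul] at this
  linarith

theorem IsReplicaCoupling.sub_mul_gap_le (hD : IsReplicaCoupling w a D C d) (hv : 0 ≤ v)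
    (hvT : 0 ≤ v + T • w) (hT : 0 ≤ T) (lam : ℝ) :
    (lam - T) * gap a v w h d T
      ≤ T * (coupledFreeEnergy a (amplitude v w 0, h) (lam • D) / 2
        - freeEnergy a (amplitude v w 0, h)) := by
  set δ := coupledFreeEnergy a (amplitude v w 0, h) (lam • D) / 2
    - freeEnergy a (amplitude v w 0, h) with hδ
  have hanti : AntitoneOn (fun u => (lam - u) * gap a v w h d u - u * δ) (Set.Icc 0 T) := by
    refine antitoneOn_of_hasDerivWithinAt_nonpos (convex_Icc 0 T)
      (((by fun_prop : Continuous fun u => lam - u).mul continuous_gap).sub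
        (by fun_prop)).continuousOn
      (fun s hs => ((((hasDerivAt_id s).const_sub lam).mul
        (hD.hasDerivAt_gap hv hvT (by rwa [interior_Icc] at hs))).sub
          ((hasDerivAt_id s).mul_const δ)).hasDerivWithinAt) fun s hs => ?_
    have hJensen := quenchedAvg_le_coupledFreeEnergy_sub a (amplitude v w s, h) ((lam - s) • D)
    have hcoupled := hD.coupledFreeEnergy_le (h := h) hv hvT lam (interior_subset hs)
    rw [map_smul, smul_eq_mul] at hJensen
    simp only [gap, id_eq, hδ]
    linarith
  have := hanti (Set.left_mem_Icc.2 hT) (Set.right_mem_Icc.2 hT) hT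
  simpa [gap] using this

end ReplicaCoupling

section Trajectory

variable {N : ℕ}

theorem spin_mul_self (s : Bool) : spin s * spin s = 1 := by
  cases s <;> simp [spin]

theorem abs_spin (s : Bool) : |spin s| = 1 := by
  cases s <;> simp [spin]

theorem overlap_self (hN : N ≠ 0) (σ : Config N) : overlap N σ σ = 1 := by
  simp [overlap, spin_mul_self, hN]

theorem abs_overlap_le_one (σ τ : Config N) : |overlap N σ τ| ≤ 1 := by
  have hsum : |∑ i, spin (σ i) * spin (τ i)| ≤ N :=
    (Finset.abs_sum_le_sum_abs _ _).trans (by simp [abs_mul, abs_spin])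
  rw [overlap, abs_mul, abs_of_nonneg (by positivity : (0 : ℝ) ≤ (N : ℝ)⁻¹)]
  calc (N : ℝ)⁻¹ * |∑ i, spin (σ i) * spin (τ i)| ≤ (N : ℝ)⁻¹ * N := by gcongr
    _ ≤ 1 := inv_mul_le_one

theorem sum_couple_mul {R : Type*} [CommRing R] (f : Fin N → R) :
    2 * ∑ p : Couple N, f p.1.1 * f p.1.2 = (∑ i, f i) ^ 2 - ∑ i, f i ^ 2 := by
  have hlt : ∑ p : Couple N, f p.1.1 * f p.1.2 = ∑ i, ∑ j, if i < j then f i * f j else 0 := by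
    rw [← Fintype.sum_prod_type' (f := fun i j => if i < j then f i * f j else 0),
      ← Finset.sum_filter]
    exact (Finset.sum_subtype (Finset.univ.filter fun p : Fin N × Fin N => p.1 < p.2)
      (by simp) (fun p : Fin N × Fin N => f p.1 * f p.2)).symm
  have hgt : ∑ p : Couple N, f p.1.1 * f p.1.2 = ∑ i, ∑ j, if j < i then f i * f j else 0 := by
    rw [hlt, Finset.sum_comm]
    simp only [mul_comm]
  have hdiag : ∑ i, f i ^ 2 = ∑ i, ∑ j, if i = j then f i * f j else 0 := by
    simp [pow_two]
  rw [eq_sub_iff_add_eq, two_mul, hdiag, pow_two, Finset.sum_mul_sum]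
  nth_rw 1 [hlt]
  rw [hgt]
  simp only [← Finset.sum_add_distrib]
  refine Finset.sum_congr rfl fun i _ => Finset.sum_congr rfl fun j _ => ?_
  obtain h | h | h := lt_trichotomy i j
  · simp [h, h.not_gt, h.ne]
  · simp [h]
  · simp [h, h.not_gt, h.ne']

/-- The monomials in the spins that multiply the disorder variables. -/
def monomial (N : ℕ) (σ : Config N) : Couple N ⊕ Fin N → ℝ :=
  Sum.elim (fun p => spin (σ p.1.1) * spin (σ p.1.2)) (fun i => spin (σ i))

/-- The squared amplitudes of the couplings and of the one-body fields. They are linear in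
`(x, t)`, so a trajectory `u ↦ (x₀ - m * u, u)` starts at `weight N x₀ 0` and has the velocity
`weight N (-m) 1`. -/
def weight (N : ℕ) (x t : ℝ) : Couple N ⊕ Fin N → ℝ :=
  Sum.elim (fun _ => t / N) (fun _ => x)

/-- The deterministic part `b * ∑ i, σ i` of the energy. -/
def field (N : ℕ) (b : ℝ) (σ : Config N) : ℝ := b * ∑ i, spin (σ i)

/-- The coupling `(N / 2) * (q₁₂ - m) ^ 2` of two replicas. -/
def overlapCoupling (N : ℕ) (m : ℝ) (p : Config N × Config N) : ℝ :=
  N / 2 * (overlap N p.1 p.2 - m) ^ 2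

theorem overlapCoupling_le {m : ℝ} (hm₀ : 0 ≤ m) (hm₁ : m ≤ 1) (p : Config N × Config N) :
    overlapCoupling N m p ≤ 2 * N := by
  have hoverlap := abs_le.1 (abs_overlap_le_one p.1 p.2)
  have hsq : (overlap N p.1 p.2 - m) ^ 2 ≤ 4 := by nlinarith [hoverlap.1, hoverlap.2]
  calc overlapCoupling N m p ≤ N / 2 * 4 := by unfold overlapCoupling; gcongr
    _ = 2 * N := by ring

theorem sum_monomial_couple (σ τ : Config N) :
    ∑ p : Couple N, monomial N σ (Sum.inl p) * monomial N τ (Sum.inl p)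
      = ((N * overlap N σ τ) ^ 2 - N) / 2 := by
  have hspin (i : Fin N) : (spin (σ i) * spin (τ i)) ^ 2 = 1 := by
    rw [mul_pow, pow_two, pow_two, spin_mul_self, spin_mul_self, one_mul]
  have hsum := sum_couple_mul fun i => spin (σ i) * spin (τ i)
  simp only [hspin, Finset.sum_const, Finset.card_univ, Fintype.card_fin, nsmul_eq_mul,
    mul_one, mul_mul_mul_comm (spin (σ _)) (spin (τ _))] at hsum
  simp only [monomial, Sum.elim_inl]
  obtain rfl | hN := eq_or_ne N 0
  · simp
  rw [eq_div_iff two_ne_zero, mul_comm, hsum, overlap, mul_inv_cancel_left₀ (by simpa using hN)]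

theorem isReplicaCoupling_overlapCoupling (hN : N ≠ 0) (m : ℝ) :
    IsReplicaCoupling (weight N (-m) 1) (monomial N) (overlapCoupling N m)
      (N / 2 * m ^ 2 + 1 / 2) (N / 2 * (1 - m) ^ 2) where
  nonneg p := by unfold overlapCoupling; positivity
  diag σ := by rw [overlapCoupling, overlap_self hN]
  cov_eq σ τ := by
    have hN' : (N : ℝ) ≠ 0 := by exact_mod_cast hN
    have hsite : ∑ i, monomial N σ (Sum.inr i) * monomial N τ (Sum.inr i) = N * overlap N σ τ := by
      rw [overlap, mul_inv_cancel_left₀ hN']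
      rfl
    simp only [cov, weight, Fintype.sum_sum_type, Sum.elim_inl, Sum.elim_inr, ← Finset.mul_sum,
      sum_monomial_couple, hsite, overlapCoupling]
    field_simp
    ring

variable {b x₀ m u : ℝ}

variable (N b x₀ m u) in
/-- The amplitudes and the deterministic part of the energy at time `u` on the trajectory
`u ↦ (x₀ - m * u, u)`. -/
def trajectory : (Couple N ⊕ Fin N → ℝ) × (Config N → ℝ) :=
  (amplitude (weight N x₀ 0) (weight N (-m) 1) u, field N b)

theorem energy_eq_ham (J : Disorder N) :
    energy N b (x₀ - m * u) u J = ham (monomial N) J (trajectory N b x₀ m u) := by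
  ext σ
  simp only [energy, ham_apply, trajectory, amplitude, weight, monomial, field,
    Fintype.sum_sum_type, Sum.elim_inl, Sum.elim_inr, Finset.mul_sum]
  ring_nf

theorem alpha_eq_freeEnergy :
    alpha N b (x₀ - m * u) u = (N : ℝ)⁻¹ * freeEnergy (monomial N) (trajectory N b x₀ m u) := by
  simp only [alpha, partition, energy_eq_ham]
  rfl

theorem weight_nonneg {x t : ℝ} (hx : 0 ≤ x) (ht : 0 ≤ t) : 0 ≤ weight N x t := by
  rintro (_ | _)
  · exact div_nonneg ht N.cast_nonneg
  · exact hx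

theorem weight_add_smul_nonneg (hu : 0 ≤ u) (hx : 0 ≤ x₀ - m * u) :
    0 ≤ weight N x₀ 0 + u • weight N (-m) 1 := by
  convert! weight_nonneg (N := N) hx hu using 1
  ext (p | i) <;> simp only [weight, Pi.add_apply, Pi.smul_apply, smul_eq_mul, Sum.elim_inl,
    Sum.elim_inr] <;> ring

theorem start_zero {x : ℝ} (hx : 0 ≤ x) : start b x 0 = x := by
  simpa using (isGreatest_start b x 0 hx le_rfl).1.2.symm

theorem coupledAlpha_eq_coupledFreeEnergy (hx₀ : 0 ≤ x₀) (lam : ℝ) :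
    coupledAlpha N b x₀ lam 0 = (2 * (N : ℝ))⁻¹ * coupledFreeEnergy (monomial N)
      (trajectory N b x₀ (qbar b x₀) 0) (lam • overlapCoupling N (qbar b x₀)) := by
  have hpartition (J : Disorder N) : coupledPartition N b x₀ lam 0 J
      = gibbsZ (ham (pairPattern (monomial N)) J ((trajectory N b x₀ (qbar b x₀) 0).1,
        fun p => (trajectory N b x₀ (qbar b x₀) 0).2 p.1
          + (trajectory N b x₀ (qbar b x₀) 0).2 p.2
          + (lam • overlapCoupling N (qbar b x₀)) p)) := by
    simp only [ham_pairPattern, ← energy_eq_ham, mul_zero, sub_zero, coupledPartition, gibbsZ,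
      qbarAt, start_zero hx₀, Fintype.sum_prod_type, Pi.add_apply, Pi.smul_apply, smul_eq_mul,
      overlapCoupling, div_mul_eq_mul_div, mul_div_assoc, mul_assoc]
  simp only [coupledAlpha, hpartition]
  rfl

theorem alpha_zero_eq_freeEnergy :
    alpha N b x₀ 0 = (N : ℝ)⁻¹ * freeEnergy (monomial N) (trajectory N b x₀ m 0) := by
  simpa using alpha_eq_freeEnergy (b := b) (x₀ := x₀) (m := m) (u := 0)

theorem Delta_eq (hx₀ : 0 ≤ x₀) (lam : ℝ) :
    Delta N b x₀ lam = (N : ℝ)⁻¹ * (coupledFreeEnergy (monomial N)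
        (trajectory N b x₀ (qbar b x₀) 0) (lam • overlapCoupling N (qbar b x₀)) / 2
      - freeEnergy (monomial N) (trajectory N b x₀ (qbar b x₀) 0)) := by
  rw [Delta, coupledAlpha_eq_coupledFreeEnergy hx₀, alpha_zero_eq_freeEnergy (m := qbar b x₀)]
  ring

variable (N b x₀ u) in
/-- The gap between the replica symmetric value and `α_N` at time `u` on the trajectory that
starts at `x₀`. -/
def rsGap : ℝ :=
  alpha N b x₀ 0 + u / 4 * (1 - qbar b x₀) ^ 2 - alpha N b (x₀ - qbar b x₀ * u) u

theorem rsGap_eq (hN : N ≠ 0) :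
    rsGap N b x₀ u = (N : ℝ)⁻¹ * gap (monomial N) (weight N x₀ 0) (weight N (-qbar b x₀) 1)
      (field N b) (N / 2 * (1 - qbar b x₀) ^ 2) u := by
  have hN' : (N : ℝ) ≠ 0 := by exact_mod_cast hN
  rw [rsGap, alpha_eq_freeEnergy, alpha_zero_eq_freeEnergy (m := qbar b x₀), gap]
  simp only [trajectory]
  field_simp
  ring

theorem rsGap_nonneg (hN : N ≠ 0) (hx₀ : 0 ≤ x₀) (hu : 0 ≤ u)
    (hx : 0 ≤ x₀ - qbar b x₀ * u) : 0 ≤ rsGap N b x₀ u := by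
  have hgap := (isReplicaCoupling_overlapCoupling hN (qbar b x₀)).gap_nonneg (h := field N b)
    (weight_nonneg hx₀ le_rfl) (weight_add_smul_nonneg hu hx) hu
  rw [rsGap_eq hN]
  positivity

theorem rsGap_le_add (hN : N ≠ 0) (hx₀ : 0 ≤ x₀) (hx : 0 ≤ x₀ - qbar b x₀ * u) {s : ℝ}
    (hs : s ∈ Set.Icc 0 u) : rsGap N b x₀ u ≤ rsGap N b x₀ s + (u - s) := by
  have hgap := (isReplicaCoupling_overlapCoupling hN (qbar b x₀)).gap_le_add (h := field N b)
    (overlapCoupling_le (qbar_nonneg b x₀) (qbar_le_one b x₀))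
    (weight_nonneg hx₀ le_rfl) (weight_add_smul_nonneg (hs.1.trans hs.2) hx) hs
  have hN' : (0 : ℝ) < N := by exact_mod_cast hN.bot_lt
  rw [rsGap_eq hN, rsGap_eq hN, inv_mul_le_iff₀ hN']
  refine hgap.trans_eq ?_
  field_simp

theorem sub_mul_rsGap_le (hN : N ≠ 0) (hx₀ : 0 ≤ x₀) (hu : 0 ≤ u)
    (hx : 0 ≤ x₀ - qbar b x₀ * u) (lam : ℝ) :
    (lam - u) * rsGap N b x₀ u ≤ u * Delta N b x₀ lam := by
  have hgap := (isReplicaCoupling_overlapCoupling hN (qbar b x₀)).sub_mul_gap_le (h := field N b)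
    (weight_nonneg hx₀ le_rfl) (weight_add_smul_nonneg hu hx) hu lam
  rw [rsGap_eq hN, Delta_eq hx₀, mul_left_comm, mul_left_comm u]
  exact mul_le_mul_of_nonneg_left hgap (by positivity)

end Trajectory

section NonInteractingSpins

variable {N : ℕ}

theorem partition_zero (b x : ℝ) (J : Disorder N) :
    partition N b x 0 J = ∏ i, (2 * Real.cosh (b + J (Sum.inr i) * √x)) := by
  have hexp (σ : Config N) : Real.exp (energy N b x 0 J σ)
      = ∏ i, Real.exp ((b + J (Sum.inr i) * √x) * spin (σ i)) := by
    rw [← Real.exp_sum, energy, zero_div, Real.sqrt_zero, zero_mul, zero_add, Finset.mul_sum,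
      Finset.mul_sum, ← Finset.sum_add_distrib]
    congr! 2
    ring
  have hcosh (y : ℝ) : 2 * Real.cosh y = ∑ s : Bool, Real.exp (y * spin s) := by
    simp [spin, Real.cosh_eq, mul_div_cancel₀]
  simp only [partition, hexp, hcosh, Finset.prod_univ_sum, Fintype.piFinset_univ]

theorem log_cosh_le_abs (y : ℝ) : Real.log (Real.cosh y) ≤ |y| := by
  refine (Real.log_le_iff_le_exp (Real.cosh_pos y)).2 ?_
  rw [Real.cosh_eq]
  linarith [Real.exp_le_exp.2 (le_abs_self y), Real.exp_le_exp.2 (neg_le_abs y)]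

theorem integrable_log_cosh (b y : ℝ) :
    Integrable (fun z => Real.log (Real.cosh (b + z * y))) (gaussianReal 0 1) := by
  have hcont : Continuous fun z : ℝ => Real.log (Real.cosh (b + z * y)) :=
    (Real.continuous_cosh.comp (by fun_prop)).log fun z => (Real.cosh_pos _).ne'
  have hbound : Integrable (fun z => b + z * y) (gaussianReal 0 1) :=
    (integrable_const b).add ((memLp_one_iff_integrable.1 (memLp_id_gaussianReal 1)).mul_const y)
  refine hbound.abs.mono' hcont.aestronglyMeasurable (Eventually.of_forall fun z => ?_)
  rw [Real.norm_of_nonneg (Real.log_nonneg (Real.one_le_cosh _))]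
  exact log_cosh_le_abs _

theorem alpha_zero (hN : N ≠ 0) (b x : ℝ) :
    alpha N b x 0
      = Real.log 2 + ∫ z, Real.log (Real.cosh (b + z * √x)) ∂(gaussianReal 0 1) := by
  have hlog (J : Disorder N) : Real.log (partition N b x 0 J)
      = ∑ i, (Real.log 2 + Real.log (Real.cosh (b + J (Sum.inr i) * √x))) := by
    rw [partition_zero, Real.log_prod fun i _ => by positivity]
    exact Finset.sum_congr rfl fun i _ => Real.log_mul two_ne_zero (Real.cosh_pos _).ne'
  have hint : Integrable (fun z => Real.log 2 + Real.log (Real.cosh (b + z * √x)))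
      (gaussianReal 0 1) := (integrable_const _).add (integrable_log_cosh b (√x))
  have hsite (i : Fin N) : ∫ J : Disorder N,
      (Real.log 2 + Real.log (Real.cosh (b + J (Sum.inr i) * √x))) ∂(disorderLaw N)
      = Real.log 2 + ∫ z, Real.log (Real.cosh (b + z * √x)) ∂(gaussianReal 0 1) := by
    refine (integral_comp_eval (μ := fun _ : Couple N ⊕ Fin N => gaussianReal 0 1)
      (i := Sum.inr i) hint.aestronglyMeasurable).trans ?_
    simp [integral_add (integrable_const _) (integrable_log_cosh b (√x))]
  have hsum := integral_finsetSum (μ := disorderLaw N) Finset.univ fun i _ => integrable_comp_eval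
    (μ := fun _ : Couple N ⊕ Fin N => gaussianReal 0 1) (i := Sum.inr i) hint
  simp only [alpha, hlog, hsum, hsite, Finset.sum_const, Finset.card_univ, Fintype.card_fin,
    nsmul_eq_mul]
  exact inv_mul_cancel_left₀ (by exact_mod_cast hN) _

end NonInteractingSpins

section ThermodynamicLimit

variable {b x₀ t : ℝ}

theorem exists_tendsto_Delta_of_lt_lambdaC {s : ℝ} (hs : (s : EReal) < lambdaC b x₀) :
    ∃ r > s, Tendsto (fun N : ℕ => Delta N b x₀ r) atTop (𝓝 0) := by
  simp only [lambdaC, lt_iSup_iff] at hs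
  obtain ⟨r, ⟨hr, hDelta⟩, hsr⟩ := hs
  exact ⟨r, EReal.coe_lt_coe_iff.1 hsr, hDelta r hr le_rfl⟩

theorem tendsto_rsGap_of_lt_lambdaC (hx₀ : 0 ≤ x₀) (ht : 0 ≤ t) (hx : 0 ≤ x₀ - qbar b x₀ * t)
    (htc : (t : EReal) < lambdaC b x₀) :
    Tendsto (fun N : ℕ => rsGap N b x₀ t) atTop (𝓝 0) := by
  obtain ⟨r, hr, hDelta⟩ := exists_tendsto_Delta_of_lt_lambdaC htc
  have hbound : Tendsto (fun N : ℕ => t * Delta N b x₀ r / (r - t)) atTop (𝓝 0) := by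
    simpa using (hDelta.const_mul t).div_const (r - t)
  refine tendsto_of_tendsto_of_tendsto_of_le_of_le' tendsto_const_nhds hbound ?_ ?_ <;>
    filter_upwards [eventually_ne_atTop 0] with N hN
  · exact rsGap_nonneg hN hx₀ ht hx
  · rw [le_div_iff₀' (sub_pos.2 hr)]
    exact sub_mul_rsGap_le hN hx₀ ht hx r

theorem tendsto_rsGap (hx₀ : 0 ≤ x₀) (ht : 0 ≤ t) (hx : 0 ≤ x₀ - qbar b x₀ * t)
    (htc : (t : EReal) ≤ lambdaC b x₀) :
    Tendsto (fun N : ℕ => rsGap N b x₀ t) atTop (𝓝 0) := by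
  obtain rfl | htpos := ht.eq_or_lt
  · simp [rsGap]
  refine tendsto_order.2 ⟨fun ε hε => ?_, fun ε hε => ?_⟩
  · filter_upwards [eventually_ne_atTop 0] with N hN
    exact hε.trans_le (rsGap_nonneg hN hx₀ ht hx)
  obtain ⟨s, hs, hst⟩ := exists_between (max_lt htpos (sub_lt_self t (half_pos hε)))
  obtain ⟨hs₀, hsε⟩ := max_lt_iff.1 hs
  have hgap := tendsto_rsGap_of_lt_lambdaC hx₀ hs₀.le
    (by nlinarith [qbar_nonneg b x₀] : 0 ≤ x₀ - qbar b x₀ * s)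
    ((EReal.coe_lt_coe_iff.2 hst).trans_le htc)
  filter_upwards [eventually_ne_atTop 0, hgap.eventually_lt_const (half_pos hε)] with N hN hgapN
  linarith [rsGap_le_add hN hx₀ hx ⟨hs₀.le, hst.le⟩]

end ThermodynamicLimit

end SK

end

theorem theorem2 (b x t : ℝ) (hx : 0 ≤ x) (ht : 0 ≤ t)
    (htc : (t : EReal) ≤ SK.lambdaC b (SK.start b x t)) :
    Filter.Tendsto (fun N : ℕ => SK.alpha N b x t) Filter.atTop
      (nhds (SK.alphaBar b x t)) := by
  obtain ⟨hx₀, hstart⟩ := (SK.isGreatest_start b x t hx ht).1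
  have hgap := (SK.tendsto_rsGap hx₀ ht (hstart ▸ hx) htc).const_sub (SK.alphaBar b x t)
  rw [sub_zero] at hgap
  refine hgap.congr' ?_
  filter_upwards [Filter.eventually_ne_atTop 0] with N hN
  rw [SK.rsGap, ← hstart, SK.alpha_zero hN, SK.alphaBar]
  ring
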